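/- In a (short) cheating-robot game play proceeds in rounds. In each round Left chooses a move and then Right, knowing Left's move, chooses a move from his own list of moves, which does not depend on Left's choice. The game stops when at least one player has no move at the beginning of a round: a player wins if they have a move and the opponent has none, and the game is a draw if neither has a move. In a disjunctive sum each player moves in one summand of their choice. A summand in which only Left (only Right) moved is replaced by the corresponding Left (Right) option; if both moved in the same summand it is replaced by the corresponding same-round option. An integer $k\ge 0$ is the game consisting of $k$ successive free moves for Left, and $-k$ that of $k$ free moves for Right. For integers $a\ge 0\ge c$ the normalized simple hot game $\{a\mid 0\mid c\}$ is the game in which each player has exactly one move, Left to the integer $a$ and Right to the integer $c$, with same-round option $0$. Let $G_i=\{a_i\mid 0\mid c_i\}$, $i=1,\dots,n$, be normalized simple hot games ($a_i\ge 0\ge c_i$ integers), indexed so that $a_i-c_i\ge a_{i+1}-c_{i+1}$ for all $i<n$. For an arbitrary integer $d$ consider the disjunctive sum $d+G_1+\dots+G_n$. Call a strategy of Left *optimal* if (i) it guarantees her every result (win $>$ draw $>$ loss) that some strategy of hers guarantees, and (ii) when the sum is played until all its summands are integers, it guarantees her the largest value of the sum of these integers that any strategy of hers guarantees; optimality for Right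 is defined symmetrically, with the smallest value in (ii). The *index-order strategy* of Left is to play in the unplayed game $G_i$ of least index, as long as there is one. Let $D_G$ be the graph with vertex set $\{1,\dots,n\}$ that has an edge $ij$, $i<j$, of weight $a_i+c_j$, whenever $a_i+c_j<0$. For a matching $M$ of $D_G$ (possibly empty), the *matching strategy* $\alpha(M)$ of Right is: when Left plays in $G_i$, reply in $G_j$ if $ij\in M$, and reply in $G_i$ if $i$ is not incident with an edge of $M$. Then: 1. The index-order strategy is optimal for Left in $d+G_1+\dots+G_n$, for every integer $d$. (This holds for every strategy that plays in index order while some $G_i$ is unplayed.) 2. If $M$ is a matching of $D_G$ of minimum weight, then the matching strategy $\alpha(M)$, completed by suitable replies where it prescribes none (when Left moves in an integer, or when the prescribed $G_j$ is no longer available because of an earlier move in an integer), is optimal for Right in $d+G_1+\dots+G_n$, with the same completion for every integer $d$. -/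

import Mathlib

/-- A short cheating-robot game `{G^L | S(G) | G^R}`: the (finite) lists of Left options and of
Right options, and the matrix of same-round options, indexed by all pairs consisting of a Left
move and a Right move. -/
inductive CRGame : Type
  | mk (m n : ℕ) (left : Fin m → CRGame) (right : Fin n → CRGame)
      (same : Fin m → Fin n → CRGame) : CRGame

namespace CRGame

/-- The number of Left moves. -/
def numLeft : CRGame → ℕ
  | mk m _ _ _ _ => m

/-- The number of Right moves. -/
def numRight : CRGame → ℕ
  | mk _ n _ _ _ => n

/-- The option reached when only Left moves. -/
def left : (G : CRGame) → Fin G.numLeft → CRGame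
  | mk _ _ l _ _ => l

/-- The option reached when only Right moves. -/
def right : (G : CRGame) → Fin G.numRight → CRGame
  | mk _ _ _ r _ => r

/-- The option reached when both players move in the same round. -/
def same : (G : CRGame) → Fin G.numLeft → Fin G.numRight → CRGame
  | mk _ _ _ _ s => s

/-- The integer games `0 = {· | · | ·}` and `k + 1 = {k | · | ·}`. -/
def nonneg : ℕ → CRGame
  | 0 => mk 0 0 Fin.elim0 Fin.elim0 (fun i _ => i.elim0)
  | k + 1 => mk 1 0 (fun _ => nonneg k) Fin.elim0 (fun _ j => j.elim0)

/-- The integer games `0 = {· | · | ·}` and `-(k + 1) = {· | · | -k}`. -/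
def nonpos : ℕ → CRGame
  | 0 => mk 0 0 Fin.elim0 Fin.elim0 (fun i _ => i.elim0)
  | k + 1 => mk 0 1 Fin.elim0 (fun _ => nonpos k) (fun i _ => i.elim0)

/-- The integer game `k`: `k` free moves for Left if `0 ≤ k`, and `-k` free moves for Right if
`k ≤ 0`. -/
def int : ℤ → CRGame
  | Int.ofNat k => nonneg k
  | Int.negSucc k => nonpos (k + 1)

/-- The game `{a | b | c}` in which each player has exactly one move: Left to `a`, Right to `c`,
with same-round option `b`. (It is a simple hot game when `a ≥ b ≥ c`.) -/
def simpleHot (a b c : ℤ) : CRGame :=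
  mk 1 1 (fun _ => int a) (fun _ => int c) (fun _ _ => int b)

end CRGame

/-! ### Play of a disjunctive sum -/

/-- A position of a disjunctive sum with summands indexed by `ι`. -/
abbrev SumPosition (ι : Type) : Type := ι → CRGame

namespace SumPosition

variable {ι : Type}

/-- A Left move in a disjunctive sum is a Left move in one of the summands. -/
abbrev LeftMove (P : SumPosition ι) : Type := (i : ι) × Fin (P i).numLeft

/-- A Right move in a disjunctive sum is a Right move in one of the summands. -/
abbrev RightMove (P : SumPosition ι) : Type := (i : ι) × Fin (P i).numRight

/-- The position after one round in which Left makes the move `l` and Right the move `r`. If they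
move in the same summand, that summand is replaced by its same-round option; otherwise Left's
summand is replaced by its Left option and Right's summand by its Right option. -/
def afterRound [DecidableEq ι] (P : SumPosition ι) (l : P.LeftMove) (r : P.RightMove) :
    SumPosition ι :=
  if h : l.1 = r.1 then
    Function.update P l.1 ((P l.1).same l.2 (Fin.cast (by rw [h]) r.2))
  else
    Function.update (Function.update P l.1 ((P l.1).left l.2)) r.1 ((P r.1).right r.2)

/-- Play stops when at least one player has no move at the beginning of a round. -/
def IsOver (P : SumPosition ι) : Prop := IsEmpty P.LeftMove ∨ IsEmpty P.RightMove

open Classical in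
/-- The result of a position in which play is over: `1` (Left wins) if only Left has a move, `-1`
(Right wins) if only Right has a move, and `0` (a draw) otherwise. So the order of `SignType` is
the preference order of Left. -/
noncomputable def result (P : SumPosition ι) : SignType :=
  if Nonempty P.LeftMove ∧ IsEmpty P.RightMove then 1
  else if IsEmpty P.LeftMove ∧ Nonempty P.RightMove then -1
  else 0

/-- All the summands are integers. -/
def IsInteger (P : SumPosition ι) : Prop := ∃ z : ι → ℤ, ∀ i, P i = CRGame.int (z i)

/-- All the summands are integers, and the sum of these integers is `k`. -/
def SumsTo [Fintype ι] (P : SumPosition ι) (k : ℤ) : Prop :=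
  ∃ z : ι → ℤ, (∀ i, P i = CRGame.int (z i)) ∧ ∑ i, z i = k

end SumPosition

open SumPosition

/-- A strategy of Left chooses a Left move in each position in which she has one. -/
abbrev LeftStrategy (ι : Type) : Type :=
  (P : SumPosition ι) → Nonempty P.LeftMove → P.LeftMove

/-- A strategy of Right, who sees Left's move of the current round before he chooses his own. -/
abbrev RightStrategy (ι : Type) : Type :=
  (P : SumPosition ι) → P.LeftMove → Nonempty P.RightMove → P.RightMove

section Strategies

variable {ι : Type} [DecidableEq ι]

/-- If Left uses `σ` from the given position on, then, whatever Right does, the play reaches a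
`final` position, and the first one that it reaches is `good`. -/
inductive LeftForces (final good : SumPosition ι → Prop) (σ : LeftStrategy ι) :
    SumPosition ι → Prop
  | reached (P : SumPosition ι) (hP : final P) (hg : good P) : LeftForces final good σ P
  | round (P : SumPosition ι) (hP : ¬ final P) (h : Nonempty P.LeftMove)
      (hr : ∀ r : P.RightMove, LeftForces final good σ (P.afterRound (σ P h) r)) :
      LeftForces final good σ P

/-- If Right uses `τ` from the given position on, then, whatever Left does, the play reaches a
`final` position, and the first one that it reaches is `good`. -/
inductive RightForces (final good : SumPosition ι → Prop) (τ : RightStrategy ι) :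
    SumPosition ι → Prop
  | reached (P : SumPosition ι) (hP : final P) (hg : good P) : RightForces final good τ P
  | round (P : SumPosition ι) (hP : ¬ final P) (h : Nonempty P.RightMove)
      (hl : ∀ l : P.LeftMove, RightForces final good τ (P.afterRound l (τ P l h))) :
      RightForces final good τ P

/-- `σ` is optimal for Left at `P` with respect to winning, drawing and losing: it guarantees
every result that any strategy of hers guarantees. -/
def LeftOutcomeOptimal (σ : LeftStrategy ι) (P : SumPosition ι) : Prop :=
  ∀ (x : SignType) (σ' : LeftStrategy ι),
    LeftForces IsOver (fun Q => x ≤ Q.result) σ' P → LeftForces IsOver (fun Q => x ≤ Q.result) σ P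

/-- `τ` is optimal for Right at `P` with respect to winning, drawing and losing. -/
def RightOutcomeOptimal (τ : RightStrategy ι) (P : SumPosition ι) : Prop :=
  ∀ (x : SignType) (τ' : RightStrategy ι),
    RightForces IsOver (fun Q => Q.result ≤ x) τ' P →
      RightForces IsOver (fun Q => Q.result ≤ x) τ P

variable [Fintype ι]

/-- `σ` maximizes the integer that Left can guarantee when the sum is played from `P` until all
its summands are integers. -/
def LeftIntegerOptimal (σ : LeftStrategy ι) (P : SumPosition ι) : Prop :=
  ∀ (v : ℤ) (σ' : LeftStrategy ι),
    LeftForces IsInteger (fun Q => ∃ k, Q.SumsTo k ∧ v ≤ k) σ' P →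
      LeftForces IsInteger (fun Q => ∃ k, Q.SumsTo k ∧ v ≤ k) σ P

/-- `τ` minimizes the integer that Right can guarantee when the sum is played from `P` until all
its summands are integers. -/
def RightIntegerOptimal (τ : RightStrategy ι) (P : SumPosition ι) : Prop :=
  ∀ (v : ℤ) (τ' : RightStrategy ι),
    RightForces IsInteger (fun Q => ∃ k, Q.SumsTo k ∧ k ≤ v) τ' P →
      RightForces IsInteger (fun Q => ∃ k, Q.SumsTo k ∧ k ≤ v) τ P

end Strategies

/-! ### Sums of normalized simple hot games -/

section NormalizedSums

variable {n : ℕ}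

/-- The disjunctive sum `d + G_1 + ⋯ + G_n` of the integer `d` and the games
`G_i = {a_i | 0 | c_i}`. The summand `none` is `d`, and the summand `some i` is `G_i`. -/
def hotSum (a c : Fin n → ℤ) (d : ℤ) : SumPosition (Option (Fin n))
  | none => CRGame.int d
  | some i => CRGame.simpleHot (a i) 0 (c i)

/-- In the position `P`, nobody has moved in the summand `G_i` yet. -/
def Unplayed (a c : Fin n → ℤ) (P : SumPosition (Option (Fin n))) (i : Fin n) : Prop :=
  P (some i) = CRGame.simpleHot (a i) 0 (c i)

/-- Left plays in the unplayed simple hot game of least index, as long as there is an unplayed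
simple hot game. -/
def IsIndexOrder (a c : Fin n → ℤ) (σ : LeftStrategy (Option (Fin n))) : Prop :=
  ∀ (P : SumPosition (Option (Fin n))) (h : Nonempty P.LeftMove) (i : Fin n),
    Unplayed a c P i → (∀ k < i, ¬ Unplayed a c P k) → (σ P h).1 = some i

/-- The auxiliary graph: `ij` with `i < j` is an edge if and only if `a_i + c_j < 0`. The loops,
which have weight `0` and are never edges of a matching, are left out. -/
def auxGraph (a c : Fin n → ℤ) : SimpleGraph (Fin n) where
  Adj i j := (i < j ∧ a i + c j < 0) ∨ (j < i ∧ a j + c i < 0)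
  symm := ⟨fun _ _ h => h.symm⟩
  loopless := ⟨fun _ h => by rcases h with h | h <;> exact lt_irrefl _ h.1⟩

open Classical in
/-- The weight of a set of edges, where the edge `ij` with `i < j` has weight `a_i + c_j`. -/
noncomputable def edgeWeight (a c : Fin n → ℤ) (M : (auxGraph a c).Subgraph) : ℤ :=
  ∑ p : Fin n × Fin n with p.1 < p.2 ∧ M.Adj p.1 p.2, (a p.1 + c p.2)

/-- `M` is a matching of the auxiliary graph, of minimum weight among all matchings. -/
def IsMinWeightMatching (a c : Fin n → ℤ) (M : (auxGraph a c).Subgraph) : Prop :=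
  M.IsMatching ∧
    ∀ M' : (auxGraph a c).Subgraph, M'.IsMatching → edgeWeight a c M ≤ edgeWeight a c M'

/-- Right plays the matching strategy from `M`: when Left plays in the simple hot game `G_i`, he
replies in `G_i` if `i` is not incident with an edge of `M`, and in `G_j` if `ij` is an edge of
`M`. (This prescribes nothing when Left moves in an integer, nor when somebody has already moved in
`G_j`, which can happen only after a move in an integer.) -/
def FollowsMatching (a c : Fin n → ℤ) (M : (auxGraph a c).Subgraph)
    (τ : RightStrategy (Option (Fin n))) : Prop :=
  ∀ (P : SumPosition (Option (Fin n))) (l : P.LeftMove) (h : Nonempty P.RightMove) (i : Fin n),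
    l.1 = some i → Unplayed a c P i →
      (i ∉ M.verts → (τ P l h).1 = some i) ∧
      (∀ j, M.Adj i j → Unplayed a c P j → (τ P l h).1 = some j)

end NormalizedSums

/-! ### Integers and simple hot games -/

namespace CRGame

/-! Both players can guarantee the same number: `d` plus the minimum weight of a matching.
Optimality follows by playing any rival strategy of one player against the good strategy of the
other: no rival can guarantee more.

Give a position the running total of its integers, an unplayed game counting 0. If Left plays in
`G_i` and Right in `G_j`, the total changes by `a_i + c_j`; if both play in the same game it does
not change. Left in index order always opens the least unplayed `i`, so a reply in `G_j` that lowers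
the total spends an edge `ij` of `auxGraph`; the edges so spent form a matching. The invariant of
`leftForces_of_isIndexOrder` expresses this.

Right keeps the total plus the weight of the edges of `M` between unplayed games from rising
(`rightForces_of_followsMatching`). Here the ordering by `a_i - c_i` enters: if Left opens the end
of greater index of an edge, she does no better than by opening the other end.

Once only integers remain, each round uses up one free move of each player, so the result is the
sign of the total whatever the players do. Thus one bound on the total settles both kinds of
optimality. -/

theorem left_nonpos (k : ℕ) (l : Fin (nonpos k).numLeft) : False := by
  cases k with
  | zero => exact l.elim0
  | succ k => exact l.elim0

theorem right_nonneg (k : ℕ) (r : Fin (nonneg k).numRight) : False := by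
  cases k with
  | zero => exact r.elim0
  | succ k => exact r.elim0

theorem left_int {G : CRGame} {z : ℤ} (hG : G = int z) (l : Fin G.numLeft) :
    0 < z ∧ G.left l = int (z - 1) := by
  subst hG
  cases z with
  | ofNat k =>
    cases k with
    | zero => exact l.elim0
    | succ k =>
      refine ⟨Int.natCast_pos.2 k.succ_pos, ?_⟩
      have h : Int.ofNat (k + 1) - 1 = Int.ofNat k := by simp
      rw [h]
      rfl
  | negSucc k => exact (left_nonpos _ l).elim

theorem right_int {G : CRGame} {z : ℤ} (hG : G = int z) (r : Fin G.numRight) :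
    z < 0 ∧ G.right r = int (z + 1) := by
  subst hG
  cases z with
  | ofNat k => exact (right_nonneg _ r).elim
  | negSucc k =>
    refine ⟨Int.negSucc_lt_zero k, ?_⟩
    cases k with
    | zero => rfl
    | succ k =>
      have h : Int.negSucc (k + 1) + 1 = Int.negSucc k := by simp [Int.negSucc_eq]
      rw [h]
      rfl

theorem nonempty_left_int {G : CRGame} {z : ℤ} (hG : G = int z) (hz : 0 < z) :
    Nonempty (Fin G.numLeft) := by
  subst hG
  obtain ⟨k, rfl⟩ : ∃ k : ℕ, z = Int.ofNat (k + 1) := ⟨(z - 1).toNat, by simp; omega⟩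
  exact ⟨(0 : Fin 1)⟩

theorem nonempty_right_int {G : CRGame} {z : ℤ} (hG : G = int z) (hz : z < 0) :
    Nonempty (Fin G.numRight) := by
  subst hG
  obtain ⟨k, rfl⟩ := Int.eq_negSucc_of_lt_zero hz
  exact ⟨(0 : Fin 1)⟩

theorem nonneg_injective : Function.Injective nonneg := by
  intro k
  induction k with
  | zero => rintro (_ | m) h <;> simp_all [nonneg]
  | succ k ih =>
    rintro (_ | m) h
    · simp [nonneg] at h
    · simp only [nonneg, mk.injEq, heq_eq_eq, true_and] at h
      rw [ih (congrFun h.1 0)]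

theorem nonpos_injective : Function.Injective nonpos := by
  intro k
  induction k with
  | zero => rintro (_ | m) h <;> simp_all [nonpos]
  | succ k ih =>
    rintro (_ | m) h
    · simp [nonpos] at h
    · simp only [nonpos, mk.injEq, heq_eq_eq, true_and] at h
      rw [ih (congrFun h.1 0)]

theorem int_injective : Function.Injective int := by
  rintro (k | k) (m | m) h
  · rw [nonneg_injective h]
  · cases k <;> simp [int, nonneg, nonpos] at h
  · cases m <;> simp [int, nonneg, nonpos] at h
  · have := nonpos_injective h
    simp_all

/-- A simple hot game offers moves to both players, an integer to at most one. So the unplayed games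
can be read off a position. -/
theorem simpleHot_ne_int (a b c z : ℤ) : simpleHot a b c ≠ int z := by
  intro h
  have hl := left_int h (0 : Fin 1)
  have hr := right_int h (0 : Fin 1)
  omega

theorem left_simpleHot {G : CRGame} {a b c : ℤ} (hG : G = simpleHot a b c)
    (l : Fin G.numLeft) : G.left l = int a := by
  subst hG
  rfl

theorem right_simpleHot {G : CRGame} {a b c : ℤ} (hG : G = simpleHot a b c)
    (r : Fin G.numRight) : G.right r = int c := by
  subst hG
  rfl

theorem same_simpleHot {G : CRGame} {a b c : ℤ} (hG : G = simpleHot a b c)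
    (l : Fin G.numLeft) (r : Fin G.numRight) : G.same l r = int b := by
  subst hG
  rfl

theorem nonempty_left_simpleHot {G : CRGame} {a b c : ℤ} (hG : G = simpleHot a b c) :
    Nonempty (Fin G.numLeft) := by
  subst hG
  exact ⟨(0 : Fin 1)⟩

theorem nonempty_right_simpleHot {G : CRGame} {a b c : ℤ} (hG : G = simpleHot a b c) :
    Nonempty (Fin G.numRight) := by
  subst hG
  exact ⟨(0 : Fin 1)⟩

end CRGame

/-! ### Forcing -/

section Forcing

variable {ι : Type} [DecidableEq ι]

theorem LeftForces.mono {final good good' : SumPosition ι → Prop} {σ : LeftStrategy ι}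
    (hgood : ∀ Q, good Q → good' Q) {P : SumPosition ι} (h : LeftForces final good σ P) :
    LeftForces final good' σ P := by
  induction h with
  | reached P hP hg => exact .reached P hP (hgood P hg)
  | round P hP h _ ih => exact .round P hP h ih

theorem RightForces.mono {final good good' : SumPosition ι → Prop} {τ : RightStrategy ι}
    (hgood : ∀ Q, good Q → good' Q) {P : SumPosition ι} (h : RightForces final good τ P) :
    RightForces final good' τ P := by
  induction h with
  | reached P hP hg => exact .reached P hP (hgood P hg)
  | round P hP h _ ih => exact .round P hP h ih

/-- If both players have a forcing strategy, then some final position is good for both. -/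
theorem LeftForces.exists_good {final good good' : SumPosition ι → Prop} {σ : LeftStrategy ι}
    {τ : RightStrategy ι} {P : SumPosition ι} (hσ : LeftForces final good σ P)
    (hτ : RightForces final good' τ P) : ∃ Q, good Q ∧ good' Q := by
  induction hσ with
  | reached P hP hg =>
    cases hτ with
    | reached _ _ hg' => exact ⟨P, hg, hg'⟩
    | round _ hP' => exact absurd hP hP'
  | round P hP h _ ih =>
    cases hτ with
    | reached _ hP' => exact absurd hP' hP
    | round _ _ h' hl => exact ih _ (hl _)

omit [DecidableEq ι] in
theorem SumPosition.SumsTo.unique [Fintype ι] {P : SumPosition ι} {k k' : ℤ} (h : P.SumsTo k)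
    (h' : P.SumsTo k') : k = k' := by
  obtain ⟨z, hz, rfl⟩ := h
  obtain ⟨z', hz', rfl⟩ := h'
  exact Finset.sum_congr rfl fun i _ => CRGame.int_injective ((hz i).symm.trans (hz' i))

/-! ### Positions whose summands are integers and simple hot games -/

/-- The summands of `P` with index `i ∈ T` are the simple hot games `{A i | 0 | C i}`, and the
other ones are the integers `z i`. -/
structure IsHotPosition (A C : ι → ℤ) (T : Finset ι) (z : ι → ℤ) (P : SumPosition ι) : Prop where
  hot : ∀ i ∈ T, P i = CRGame.simpleHot (A i) 0 (C i)
  zero : ∀ i ∈ T, z i = 0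
  int : ∀ i ∉ T, P i = CRGame.int (z i)

namespace IsHotPosition

variable {A C z : ι → ℤ} {T : Finset ι} {P : SumPosition ι}

/-- No integer gives both players a move, so the common summand is hot. Its recorded value 0 is
already its same-round option, so `z` does not change. -/
theorem afterRound_same (hP : IsHotPosition A C T z P) (l : P.LeftMove) (r : P.RightMove)
    (h : l.1 = r.1) :
    l.1 ∈ T ∧ IsHotPosition A C (T.erase l.1) z (P.afterRound l r) := by
  obtain ⟨i, l⟩ := l
  obtain ⟨j, r⟩ := r
  obtain rfl : i = j := h
  have hi : i ∈ T := by
    by_contra hi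
    have h₁ := (CRGame.left_int (hP.int i hi) l).1
    have h₂ := (CRGame.right_int (hP.int i hi) r).1
    omega
  have hround : P.afterRound ⟨i, l⟩ ⟨i, r⟩ = Function.update P i (CRGame.int 0) := by
    rw [SumPosition.afterRound, dif_pos rfl]
    congr 1
    exact CRGame.same_simpleHot (hP.hot i hi) _ _
  refine ⟨hi, ?_⟩
  rw [hround]
  refine ⟨fun k hk => ?_, fun k hk => hP.zero k (Finset.mem_of_mem_erase hk), fun k hk => ?_⟩
  · rw [Function.update_of_ne (Finset.ne_of_mem_erase hk)]
    exact hP.hot k (Finset.mem_of_mem_erase hk)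
  · obtain rfl | hki := eq_or_ne k i
    · rw [Function.update_self, hP.zero k hi]
    · rw [Function.update_of_ne hki]
      exact hP.int k fun hkT => hk (Finset.mem_erase.2 ⟨hki, hkT⟩)

theorem left_eq (hP : IsHotPosition A C T z P) (l : P.LeftMove) :
    (P l.1).left l.2 = CRGame.int (z l.1 + if l.1 ∈ T then A l.1 else -1) := by
  split_ifs with h
  · rw [hP.zero _ h, zero_add, CRGame.left_simpleHot (hP.hot _ h)]
  · rw [(CRGame.left_int (hP.int _ h) l.2).2, sub_eq_add_neg]

theorem right_eq (hP : IsHotPosition A C T z P) (r : P.RightMove) :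
    (P r.1).right r.2 = CRGame.int (z r.1 + if r.1 ∈ T then C r.1 else 1) := by
  split_ifs with h
  · rw [hP.zero _ h, zero_add, CRGame.right_simpleHot (hP.hot _ h)]
  · rw [(CRGame.right_int (hP.int _ h) r.2).2]

theorem afterRound_ne (hP : IsHotPosition A C T z P) (l : P.LeftMove) (r : P.RightMove)
    (h : l.1 ≠ r.1) :
    IsHotPosition A C ((T.erase l.1).erase r.1)
      (z + Pi.single l.1 (if l.1 ∈ T then A l.1 else -1) +
        Pi.single r.1 (if r.1 ∈ T then C r.1 else 1)) (P.afterRound l r) := by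
  rw [SumPosition.afterRound, dif_neg h]
  refine ⟨fun k hk => ?_, fun k hk => ?_, fun k hk => ?_⟩
  · simp only [Finset.mem_erase] at hk
    rw [Function.update_of_ne hk.1, Function.update_of_ne hk.2.1, hP.hot k hk.2.2]
  · simp only [Finset.mem_erase] at hk
    simp [hk.1, hk.2.1, hP.zero k hk.2.2]
  · obtain rfl | hkr := eq_or_ne k r.1
    · rw [Function.update_self, hP.right_eq r]
      simp [h.symm]
    · rw [Function.update_of_ne hkr]
      obtain rfl | hkl := eq_or_ne k l.1
      · rw [Function.update_self, hP.left_eq l]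
        simp [h]
      · rw [Function.update_of_ne hkl, hP.int k fun hkT => hk (by simp [hkr, hkl, hkT])]
        simp [hkr, hkl]

theorem sum_afterRound_ne [Fintype ι] (z : ι → ℤ) (i j : ι) (x y : ℤ) :
    ∑ k, (z + Pi.single i x + Pi.single j y : ι → ℤ) k = ∑ k, z k + x + y := by
  simp [Finset.sum_add_distrib]

omit [DecidableEq ι] in
theorem nonempty_leftMove (hP : IsHotPosition A C T z P) (hT : T.Nonempty) :
    Nonempty P.LeftMove := by
  obtain ⟨i, hi⟩ := hT
  obtain ⟨l⟩ := CRGame.nonempty_left_simpleHot (hP.hot i hi)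
  exact ⟨⟨i, l⟩⟩

omit [DecidableEq ι] in
theorem nonempty_rightMove (hP : IsHotPosition A C T z P) (hT : T.Nonempty) :
    Nonempty P.RightMove := by
  obtain ⟨i, hi⟩ := hT
  obtain ⟨r⟩ := CRGame.nonempty_right_simpleHot (hP.hot i hi)
  exact ⟨⟨i, r⟩⟩

omit [DecidableEq ι] in
theorem not_isOver (hP : IsHotPosition A C T z P) (hT : T.Nonempty) : ¬ P.IsOver := by
  rintro (h | h)
  · exact not_isEmpty_iff.2 (hP.nonempty_leftMove hT) h
  · exact not_isEmpty_iff.2 (hP.nonempty_rightMove hT) h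

omit [DecidableEq ι] in
theorem not_isInteger (hP : IsHotPosition A C T z P) (hT : T.Nonempty) : ¬ P.IsInteger := by
  rintro ⟨y, hy⟩
  obtain ⟨i, hi⟩ := hT
  exact CRGame.simpleHot_ne_int _ _ _ _ ((hP.hot i hi).symm.trans (hy i))

/-! ### Play among integers -/

omit [DecidableEq ι] in
theorem isInteger (hP : IsHotPosition A C ∅ z P) : P.IsInteger :=
  ⟨z, fun i => hP.int i (Finset.notMem_empty i)⟩

omit [DecidableEq ι] in
theorem nonempty_leftMove_iff (hP : IsHotPosition A C ∅ z P) :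
    Nonempty P.LeftMove ↔ ∃ i, 0 < z i := by
  constructor
  · rintro ⟨i, l⟩
    exact ⟨i, (CRGame.left_int (hP.int i (Finset.notMem_empty i)) l).1⟩
  · rintro ⟨i, hi⟩
    obtain ⟨l⟩ := CRGame.nonempty_left_int (hP.int i (Finset.notMem_empty i)) hi
    exact ⟨⟨i, l⟩⟩

omit [DecidableEq ι] in
theorem nonempty_rightMove_iff (hP : IsHotPosition A C ∅ z P) :
    Nonempty P.RightMove ↔ ∃ i, z i < 0 := by
  constructor
  · rintro ⟨i, r⟩
    exact ⟨i, (CRGame.right_int (hP.int i (Finset.notMem_empty i)) r).1⟩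
  · rintro ⟨i, hi⟩
    obtain ⟨r⟩ := CRGame.nonempty_right_int (hP.int i (Finset.notMem_empty i)) hi
    exact ⟨⟨i, r⟩⟩

variable [Fintype ι]

omit [DecidableEq ι] in
theorem sumsTo (hP : IsHotPosition A C ∅ z P) : P.SumsTo (∑ i, z i) :=
  ⟨z, fun i => hP.int i (Finset.notMem_empty i), rfl⟩

-- When play is over, no two of the integers have opposite signs, so nothing cancels in their sum.
omit [DecidableEq ι] in
theorem result_eq_sign (hP : IsHotPosition A C ∅ z P) (hover : P.IsOver) :
    P.result = SignType.sign (∑ i, z i) := by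
  unfold SumPosition.IsOver at hover
  unfold SumPosition.result
  simp only [← not_nonempty_iff, hP.nonempty_leftMove_iff, hP.nonempty_rightMove_iff] at hover ⊢
  by_cases hl : ∃ i, 0 < z i
  · have hr : ¬ ∃ i, z i < 0 := hover.resolve_left (not_not.2 hl)
    rw [if_pos ⟨hl, hr⟩, sign_pos]
    push Not at hr
    obtain ⟨i, hi⟩ := hl
    exact Finset.sum_pos' (fun i _ => hr i) ⟨i, Finset.mem_univ i, hi⟩
  · rw [if_neg fun h => hl h.1]
    by_cases hr : ∃ i, z i < 0
    · rw [if_pos ⟨hl, hr⟩, sign_neg]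
      push Not at hl
      obtain ⟨i, hi⟩ := hr
      exact Finset.sum_neg' (fun i _ => hl i) ⟨i, Finset.mem_univ i, hi⟩
    · rw [if_neg fun h => hr h.2]
      push Not at hl hr
      simp [fun i => le_antisymm (hl i) (hr i)]

/-- A round in integers keeps their sum and uses up a free move of Left. -/
theorem exists_afterRound (hP : IsHotPosition A C ∅ z P) (l : P.LeftMove) (r : P.RightMove) :
    ∃ z', IsHotPosition A C ∅ z' (P.afterRound l r) ∧ ∑ i, z' i = ∑ i, z i ∧
      ∑ i, (z' i).toNat < ∑ i, (z i).toNat := by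
  have hl := (CRGame.left_int (hP.int l.1 (Finset.notMem_empty _)) l.2).1
  have hr := (CRGame.right_int (hP.int r.1 (Finset.notMem_empty _)) r.2).1
  have hne : l.1 ≠ r.1 := fun h => by rw [h] at hl; omega
  refine ⟨_, by simpa using hP.afterRound_ne l r hne, ?_, ?_⟩
  · simp [Finset.sum_add_distrib]
  -- Right's summand rises from a negative value to at most 0, so its `toNat` stays 0; Left's drops
  -- by 1.
  · refine Finset.sum_lt_sum (fun i _ => ?_) ⟨l.1, Finset.mem_univ _, ?_⟩
    · obtain rfl | hir := eq_or_ne i r.1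
      · simp [hne.symm]
        omega
      · obtain rfl | hil := eq_or_ne i l.1
        · simp [hir]
        · simp [hir, hil]
    · simp [hne]
      omega

/-- The strategy is arbitrary because every round among integers preserves the sum; induction on
Left's remaining free moves. -/
theorem leftForces_result (hP : IsHotPosition A C ∅ z P) (σ : LeftStrategy ι) :
    LeftForces SumPosition.IsOver (fun Q => Q.result = SignType.sign (∑ i, z i)) σ P := by
  induction hm : ∑ i, (z i).toNat using Nat.strong_induction_on generalizing z P with
  | _ m ih =>
    by_cases hover : P.IsOver
    · exact .reached P hover (hP.result_eq_sign hover)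
    · have h := hover
      simp only [SumPosition.IsOver, not_or, not_isEmpty_iff] at h
      refine .round P hover h.1 fun r => ?_
      obtain ⟨z', hP', hsum, hlt⟩ := hP.exists_afterRound (σ P h.1) r
      rw [← hsum]
      exact ih _ (hm ▸ hlt) hP' rfl

theorem rightForces_result (hP : IsHotPosition A C ∅ z P) (τ : RightStrategy ι) :
    RightForces SumPosition.IsOver (fun Q => Q.result = SignType.sign (∑ i, z i)) τ P := by
  induction hm : ∑ i, (z i).toNat using Nat.strong_induction_on generalizing z P with
  | _ m ih =>
    by_cases hover : P.IsOver
    · exact .reached P hover (hP.result_eq_sign hover)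
    · have h := hover
      simp only [SumPosition.IsOver, not_or, not_isEmpty_iff] at h
      refine .round P hover h.2 fun l => ?_
      obtain ⟨z', hP', hsum, hlt⟩ := hP.exists_afterRound l (τ P l h.2)
      rw [← hsum]
      exact ih _ (hm ▸ hlt) hP' rfl

end IsHotPosition

end Forcing

/-! ### Matchings -/

section Matchings

variable {n : ℕ} {a c : Fin n → ℤ}

theorem edgeWeight_bot : edgeWeight a c ⊥ = 0 := by
  simp [edgeWeight]

theorem isMatching_bot : (⊥ : (auxGraph a c).Subgraph).IsMatching := fun _ h => h.elim

theorem edgeWeight_sup_subgraphOfAdj {N : (auxGraph a c).Subgraph} {i j : Fin n} (hij : i < j)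
    (hadj : (auxGraph a c).Adj i j) (hi : i ∉ N.verts) :
    edgeWeight a c (N ⊔ (auxGraph a c).subgraphOfAdj hadj) =
      edgeWeight a c N + (a i + c j) := by
  classical
  unfold edgeWeight
  have h : (Finset.univ.filter fun p : Fin n × Fin n =>
      p.1 < p.2 ∧ (N ⊔ (auxGraph a c).subgraphOfAdj hadj).Adj p.1 p.2) =
      insert (i, j) (Finset.univ.filter fun p : Fin n × Fin n => p.1 < p.2 ∧ N.Adj p.1 p.2) := by
    ext ⟨x, y⟩
    simp only [Finset.mem_filter, Finset.mem_univ, true_and, Finset.mem_insert, Prod.mk.injEq,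
      SimpleGraph.Subgraph.sup_adj, SimpleGraph.subgraphOfAdj_adj, Sym2.eq_iff]
    constructor
    · rintro ⟨hxy, h | ⟨rfl, rfl⟩ | ⟨rfl, rfl⟩⟩
      · exact .inr ⟨hxy, h⟩
      · exact .inl ⟨rfl, rfl⟩
      · exact absurd hij hxy.asymm
    · rintro (⟨rfl, rfl⟩ | ⟨hxy, h⟩)
      · exact ⟨hij, .inr (.inl ⟨rfl, rfl⟩)⟩
      · exact ⟨hxy, .inl h⟩
  rw [h, Finset.sum_insert, add_comm]
  simp only [Finset.mem_filter, Finset.mem_univ, true_and, not_and]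
  exact fun _ h => hi (N.edge_vert h)

theorem exists_isMinWeightMatching (a c : Fin n → ℤ) :
    ∃ M : (auxGraph a c).Subgraph, IsMinWeightMatching a c M := by
  obtain ⟨M, hM, hmin⟩ := Set.exists_min_image
    {M : (auxGraph a c).Subgraph | M.IsMatching} (edgeWeight a c) (Set.toFinite _)
    ⟨⊥, isMatching_bot⟩
  exact ⟨M, hM, hmin⟩

open Classical in
/-- The weight of the edges of `M` with both ends in `T`. -/
noncomputable def edgeWeightOn (a c : Fin n → ℤ) (M : (auxGraph a c).Subgraph)
    (T : Finset (Option (Fin n))) : ℤ :=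
  ∑ p : Fin n × Fin n with (p.1 < p.2 ∧ M.Adj p.1 p.2) ∧ some p.1 ∈ T ∧ some p.2 ∈ T,
    (a p.1 + c p.2)

theorem edgeWeightOn_empty (M : (auxGraph a c).Subgraph) : edgeWeightOn a c M ∅ = 0 := by
  simp [edgeWeightOn]

/-- In a matching, `xy` is the only edge at `x` or `y`, hence the only one lost. The conditions on
`T'` cover both uses: both ends played, or only one. -/
theorem edgeWeightOn_eq_of_adj {M : (auxGraph a c).Subgraph} (hM : M.IsMatching)
    {T T' : Finset (Option (Fin n))} {x y : Fin n} (hxy : x < y) (hadj : M.Adj x y)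
    (hx : some x ∈ T) (hy : some y ∈ T) (hT' : T' ⊆ T) (hxy' : some x ∉ T' ∨ some y ∉ T')
    (hT : ∀ i ∈ T, i ≠ some x → i ≠ some y → i ∈ T') :
    edgeWeightOn a c M T = edgeWeightOn a c M T' + (a x + c y) := by
  classical
  unfold edgeWeightOn
  have h : (Finset.univ.filter fun p : Fin n × Fin n =>
      (p.1 < p.2 ∧ M.Adj p.1 p.2) ∧ some p.1 ∈ T ∧ some p.2 ∈ T) =
      insert (x, y) (Finset.univ.filter fun p : Fin n × Fin n =>
        (p.1 < p.2 ∧ M.Adj p.1 p.2) ∧ some p.1 ∈ T' ∧ some p.2 ∈ T') := by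
    ext ⟨u, w⟩
    simp only [Finset.mem_filter, Finset.mem_univ, true_and, Finset.mem_insert, Prod.mk.injEq]
    constructor
    · rintro ⟨⟨huw, h⟩, hu, hw⟩
      by_cases hux : u = x
      · subst hux
        exact .inl ⟨rfl, hM.eq_of_adj_left h hadj⟩
      by_cases hwy : w = y
      · subst hwy
        exact absurd (hM.eq_of_adj_right h hadj) hux
      refine .inr ⟨⟨huw, h⟩, hT _ hu (by simpa using hux) ?_, hT _ hw ?_ (by simpa using hwy)⟩
      · rintro ⟨⟩
        obtain rfl := hM.eq_of_adj_left h hadj.symm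
        exact absurd hxy huw.asymm
      · rintro ⟨⟩
        obtain rfl := hM.eq_of_adj_right h hadj.symm
        exact absurd hxy huw.asymm
    · rintro (⟨rfl, rfl⟩ | ⟨h, hu, hw⟩)
      · exact ⟨⟨hxy, hadj⟩, hx, hy⟩
      · exact ⟨h, hT' hu, hT' hw⟩
  rw [h, Finset.sum_insert, add_comm]
  simp only [Finset.mem_filter, Finset.mem_univ, true_and]
  tauto

theorem edgeWeightOn_erase {M : (auxGraph a c).Subgraph} {T : Finset (Option (Fin n))} {i : Fin n}
    (h : ∀ j, M.Adj i j → some j ∉ T) :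
    edgeWeightOn a c M (T.erase (some i)) = edgeWeightOn a c M T := by
  classical
  unfold edgeWeightOn
  congr 1
  ext ⟨u, w⟩
  simp only [Finset.mem_filter, Finset.mem_univ, true_and, Finset.mem_erase, ne_eq,
    Option.some.injEq]
  constructor
  · tauto
  · rintro ⟨⟨huw, hadj⟩, hu, hw⟩
    refine ⟨⟨huw, hadj⟩, ⟨?_, hu⟩, ?_, hw⟩
    · rintro rfl
      exact h _ hadj hw
    · rintro rfl
      exact h _ hadj.symm hu

end Matchings

/-! ### The two strategies -/

section Strategies

variable {n : ℕ} {a c : Fin n → ℤ}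

/-- The hot summands of a sum in which the summand `none` is an integer. -/
abbrev IsHotSumPosition (a c : Fin n → ℤ) (T : Finset (Option (Fin n))) (z : Option (Fin n) → ℤ)
    (P : SumPosition (Option (Fin n))) : Prop :=
  IsHotPosition (fun i => i.elim 0 a) (fun i => i.elim 0 c) T z P

theorem isHotSumPosition_hotSum (a c : Fin n → ℤ) (d : ℤ) :
    IsHotSumPosition a c (Finset.univ.erase none) (Pi.single none d) (hotSum a c d) := by
  refine ⟨?_, ?_, ?_⟩
  · rintro (_ | i) hi
    · simp at hi
    · rfl
  · rintro (_ | i) hi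
    · simp at hi
    · simp
  · rintro (_ | i) hi
    · simp [hotSum]
    · simp at hi

variable {T : Finset (Option (Fin n))} {z : Option (Fin n) → ℤ}
  {P : SumPosition (Option (Fin n))}

theorem IsHotPosition.unplayed_iff (hP : IsHotSumPosition a c T z P) (i : Fin n) :
    Unplayed a c P i ↔ some i ∈ T := by
  refine ⟨fun h => ?_, fun h => hP.hot _ h⟩
  by_contra hi
  exact CRGame.simpleHot_ne_int _ _ _ _ (Eq.symm h |>.trans (hP.int _ hi))

theorem exists_some_mem (hnone : none ∉ T) (hT : T.Nonempty) : ∃ i : Fin n, some i ∈ T := by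
  obtain ⟨_ | i, hi⟩ := hT
  · exact absurd hi hnone
  · exact ⟨i, hi⟩

/-- The invariant `hv` ranges over all matchings of the unplayed games, so no minimum has to be
recomputed after a round. -/
theorem leftForces_of_isIndexOrder {final good : SumPosition (Option (Fin n)) → Prop}
    {σ : LeftStrategy (Option (Fin n))} {v : ℤ} (ha : ∀ i, 0 ≤ a i) (hσ : IsIndexOrder a c σ)
    (hfinal : ∀ T z P, IsHotSumPosition a c T z P → T.Nonempty → ¬ final P)
    (hend : ∀ z P, IsHotSumPosition a c ∅ z P → v ≤ ∑ i, z i → LeftForces final good σ P)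
    (hP : IsHotSumPosition a c T z P) (hnone : none ∉ T)
    (hv : ∀ N : (auxGraph a c).Subgraph, N.IsMatching → (∀ i ∈ N.verts, some i ∈ T) →
      v ≤ ∑ i, z i + edgeWeight a c N) :
    LeftForces final good σ P := by
  induction hm : T.card using Nat.strong_induction_on generalizing T z P with
  | _ m ih =>
    obtain rfl | hT := T.eq_empty_or_nonempty
    · refine hend z P hP ?_
      simpa [edgeWeight_bot] using hv ⊥ isMatching_bot fun i hi => hi.elim
    have hmove := hP.nonempty_leftMove hT
    refine .round P (hfinal T z P hP hT) hmove fun r => ?_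
    obtain ⟨i, hi, hmin⟩ : ∃ i : Fin n, some i ∈ T ∧ ∀ k < i, some k ∉ T := by
      obtain ⟨i, hi, hmin⟩ := WellFounded.has_min (wellFounded_lt (α := Fin n))
        {i | some i ∈ T} (exists_some_mem hnone hT)
      exact ⟨i, hi, fun k hk hkT => hmin k hkT hk⟩
    have hl : (σ P hmove).1 = some i := hσ P hmove i ((hP.unplayed_iff i).2 hi)
      fun k hk h => hmin k hk ((hP.unplayed_iff k).1 h)
    by_cases hr : (σ P hmove).1 = r.1
    -- The total is unchanged and fewer matchings remain to be tested.
    · have hP' := (hP.afterRound_same _ r hr).2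
      rw [hl] at hP'
      exact ih _ (hm ▸ Finset.card_erase_lt_of_mem hi) hP' (fun h => hnone (Finset.mem_of_mem_erase h))
        (fun N hN h => hv N hN fun i hi => Finset.mem_of_mem_erase (h i hi)) rfl
    · have hP' := hP.afterRound_ne _ r hr
      rw [hl] at hP' hr
      refine ih _ (hm ▸ (Finset.card_erase_le.trans_lt (Finset.card_erase_lt_of_mem hi))) hP'
        (fun h => hnone (Finset.mem_of_mem_erase (Finset.mem_of_mem_erase h)))
        (fun N hN h => ?_) rfl
      have hN' : ∀ k ∈ N.verts, some k ∈ T := fun k hk =>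
        Finset.mem_of_mem_erase (Finset.mem_of_mem_erase (h k hk))
      rw [IsHotPosition.sum_afterRound_ne, if_pos hi]
      have hle := hv N hN hN'
      have hai := ha i
      by_cases hrT : r.1 ∈ T
      · obtain ⟨j, hj⟩ : ∃ j, r.1 = some j :=
          Option.ne_none_iff_exists'.1 fun h => hnone (h ▸ hrT)
        rw [hj] at hrT hr h
        rw [hj, if_pos hrT]
        change v ≤ _ + a i + c j + _
        have hij : i < j := lt_of_le_of_ne (not_lt.1 fun hlt => hmin j hlt hrT)
          fun h => hr (congrArg some h)
        -- If the round lowers the total, its loss is the weight of the edge `ij`: apply the old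
        -- invariant to `N` enlarged by `ij`.
        by_cases hneg : a i + c j < 0
        · have hadj : (auxGraph a c).Adj i j := .inl ⟨hij, hneg⟩
          have hiN : i ∉ N.verts := fun hiN => by simpa using h i hiN
          have hjN : j ∉ N.verts := fun hjN => by simpa using h j hjN
          have hle' := hv (N ⊔ (auxGraph a c).subgraphOfAdj hadj)
            (hN.sup (SimpleGraph.Subgraph.IsMatching.subgraphOfAdj hadj) (by
              rw [SimpleGraph.support_subgraphOfAdj, hN.support_eq_verts]
              simp [hiN, hjN])) (by
              intro k hk
              simp only [SimpleGraph.Subgraph.verts_sup, SimpleGraph.subgraphOfAdj_verts,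
                Set.mem_union, Set.mem_insert_iff, Set.mem_singleton_iff] at hk
              obtain hk | rfl | rfl := hk
              · exact hN' k hk
              · exact hi
              · exact hrT)
          rw [edgeWeight_sup_subgraphOfAdj hij hadj hiN] at hle'
          linarith
        · linarith
      -- Right spent a free move, which raises the total by 1.
      · rw [if_neg hrT]
        change v ≤ _ + a i + 1 + _
        linarith

/-- The matching strategy, completed as follows: if the prescribed reply is not available, then
Right replies in the game in which Left moved, and after a move in an integer he replies in the
unplayed game of greatest index. -/
theorem exists_matchingStrategy (M : (auxGraph a c).Subgraph) (hM : M.IsMatching) :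
    ∃ τ : RightStrategy (Option (Fin n)), FollowsMatching a c M τ ∧
      ∀ (P : SumPosition (Option (Fin n))) (l : P.LeftMove) (h : Nonempty P.RightMove),
        (∀ i, l.1 = some i → Unplayed a c P i → (∀ j, M.Adj i j → ¬ Unplayed a c P j) →
          (τ P l h).1 = some i) ∧
        ((∀ i, l.1 = some i → ¬ Unplayed a c P i) → ∀ j, Unplayed a c P j →
          (∀ k, j < k → ¬ Unplayed a c P k) → (τ P l h).1 = some j) := by
  have move {P : SumPosition (Option (Fin n))} {j : Fin n} (hj : Unplayed a c P j) :
      ∃ r : P.RightMove, r.1 = some j := by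
    obtain ⟨r⟩ := CRGame.nonempty_right_simpleHot hj
    exact ⟨⟨some j, r⟩, rfl⟩
  have key (P : SumPosition (Option (Fin n))) (l : P.LeftMove) (h : Nonempty P.RightMove) :
      ∃ r : P.RightMove,
        (∀ i, l.1 = some i → Unplayed a c P i → ∀ j, M.Adj i j → Unplayed a c P j →
          r.1 = some j) ∧
        (∀ i, l.1 = some i → Unplayed a c P i → (∀ j, M.Adj i j → ¬ Unplayed a c P j) →
          r.1 = some i) ∧
        ((∀ i, l.1 = some i → ¬ Unplayed a c P i) → ∀ j, Unplayed a c P j →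
          (∀ k, j < k → ¬ Unplayed a c P k) → r.1 = some j) := by
    by_cases hl : ∃ i, l.1 = some i ∧ Unplayed a c P i
    · obtain ⟨i, hli, hi⟩ := hl
      by_cases hj : ∃ j, M.Adj i j ∧ Unplayed a c P j
      · obtain ⟨j, hij, hj⟩ := hj
        obtain ⟨r, hr⟩ := move hj
        refine ⟨r, fun i' hi' _ j' hij' _ => ?_, fun i' hi' _ hnot => ?_,
          fun hnot => absurd hi (hnot i hli)⟩
        · obtain rfl : i = i' := Option.some_injective _ (hli.symm.trans hi')
          rw [hr, hM.eq_of_adj_left hij hij']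
        · obtain rfl : i = i' := Option.some_injective _ (hli.symm.trans hi')
          exact absurd hj (hnot j hij)
      · obtain ⟨r, hr⟩ := move hi
        refine ⟨r, fun i' hi' _ j' hij' hj' => ?_, fun i' hi' _ _ => hr.trans (hli.symm.trans hi'),
          fun hnot => absurd hi (hnot i hli)⟩
        obtain rfl : i = i' := Option.some_injective _ (hli.symm.trans hi')
        exact absurd ⟨j', hij', hj'⟩ hj
    · push Not at hl
      by_cases hj : ∃ j, Unplayed a c P j ∧ ∀ k, j < k → ¬ Unplayed a c P k
      · obtain ⟨j, hj, hmax⟩ := hj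
        obtain ⟨r, hr⟩ := move hj
        refine ⟨r, fun i hi h => absurd h (hl i hi), fun i hi h => absurd h (hl i hi),
          fun _ j' hj' hmax' => ?_⟩
        rw [hr, le_antisymm (not_lt.1 fun h => hmax' j h hj) (not_lt.1 fun h => hmax j' h hj')]
      · obtain ⟨r⟩ := h
        exact ⟨r, fun i hi h => absurd h (hl i hi), fun i hi h => absurd h (hl i hi),
          fun _ j hj' hmax => absurd ⟨j, hj', hmax⟩ hj⟩
  choose τ h₁ h₂ h₃ using key
  refine ⟨τ, fun P l h i hli hi => ⟨fun hiM => ?_, fun j hij hj => h₁ P l h i hli hi j hij hj⟩,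
    fun P l h => ⟨h₂ P l h, h₃ P l h⟩⟩
  exact h₂ P l h i hli hi fun j hij => absurd (M.edge_vert hij) hiM

/-- The invariant is `hv`: the total plus the weight of the edges of `M` still intact is at most
`v`. -/
theorem rightForces_of_followsMatching {final good : SumPosition (Option (Fin n)) → Prop}
    {M : (auxGraph a c).Subgraph} {τ : RightStrategy (Option (Fin n))} {v : ℤ}
    (ha : ∀ i, 0 ≤ a i) (hc : ∀ i, c i ≤ 0)
    (hindex : ∀ i j : Fin n, i ≤ j → a j - c j ≤ a i - c i) (hM : M.IsMatching)
    (hτ : FollowsMatching a c M τ)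
    (hτ' : ∀ (P : SumPosition (Option (Fin n))) (l : P.LeftMove) (h : Nonempty P.RightMove),
      (∀ i, l.1 = some i → Unplayed a c P i → (∀ j, M.Adj i j → ¬ Unplayed a c P j) →
        (τ P l h).1 = some i) ∧
      ((∀ i, l.1 = some i → ¬ Unplayed a c P i) → ∀ j, Unplayed a c P j →
        (∀ k, j < k → ¬ Unplayed a c P k) → (τ P l h).1 = some j))
    (hfinal : ∀ T z P, IsHotSumPosition a c T z P → T.Nonempty → ¬ final P)
    (hend : ∀ z P, IsHotSumPosition a c ∅ z P → ∑ i, z i ≤ v → RightForces final good τ P)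
    (hP : IsHotSumPosition a c T z P) (hnone : none ∉ T)
    (hv : ∑ i, z i + edgeWeightOn a c M T ≤ v) :
    RightForces final good τ P := by
  induction hm : T.card using Nat.strong_induction_on generalizing T z P with
  | _ m ih =>
    obtain rfl | hT := T.eq_empty_or_nonempty
    · exact hend z P hP (by simpa [edgeWeightOn_empty] using hv)
    have hmove := hP.nonempty_rightMove hT
    refine .round P (hfinal T z P hP hT) hmove fun l => ?_
    by_cases hlT : l.1 ∈ T
    · obtain ⟨i, hli⟩ : ∃ i, l.1 = some i :=
        Option.ne_none_iff_exists'.1 fun h => hnone (h ▸ hlT)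
      rw [hli] at hlT
      have hi := (hP.unplayed_iff i).2 hlT
      by_cases hpartner : ∃ j, M.Adj i j ∧ some j ∈ T
      · obtain ⟨j, hij, hj⟩ := hpartner
        have hr := (hτ P l hmove i hli hi).2 j hij ((hP.unplayed_iff j).2 hj)
        have hne : i ≠ j := hij.ne
        have hP' := hP.afterRound_ne l (τ P l hmove) (by rw [hli, hr]; simpa using hne)
        rw [hli, hr, if_pos hlT, if_pos hj] at hP'
        refine ih _ (hm ▸ Finset.card_erase_le.trans_lt (Finset.card_erase_lt_of_mem hlT)) hP'
          (fun h => hnone (Finset.mem_of_mem_erase (Finset.mem_of_mem_erase h))) ?_ rfl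
        rw [IsHotPosition.sum_afterRound_ne]
        change _ + a i + c j + _ ≤ v
        have hsub : (T.erase (some i)).erase (some j) ⊆ T :=
          (Finset.erase_subset _ _).trans (Finset.erase_subset _ _)
        obtain hlt | hlt := lt_or_gt_of_ne hne
        · have := edgeWeightOn_eq_of_adj hM hlt hij hlT hj hsub (.inr (by simp))
            (fun k hk h₁ h₂ => by simp [hk, h₁, h₂])
          linarith
        · have := edgeWeightOn_eq_of_adj hM hlt hij.symm hj hlT hsub (.inl (by simp))
            (fun k hk h₁ h₂ => by simp [hk, h₁, h₂])
          -- Left opened the end of greater index; the ordering gives `a i + c j ≤ a j + c i`, the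
          -- weight of the edge.
          have := hindex j i hlt.le
          linarith
      · push Not at hpartner
        have hr := (hτ' P l hmove).1 i hli hi
          fun j hij hj => hpartner j hij ((hP.unplayed_iff j).1 hj)
        have hP' := (hP.afterRound_same l (τ P l hmove) (hli.trans hr.symm)).2
        rw [hli] at hP'
        refine ih _ (hm ▸ Finset.card_erase_lt_of_mem hlT) hP'
          (fun h => hnone (Finset.mem_of_mem_erase h)) ?_ rfl
        rwa [edgeWeightOn_erase hpartner]
    · obtain ⟨j, hj, hmax⟩ : ∃ j : Fin n, some j ∈ T ∧ ∀ k, j < k → some k ∉ T := by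
        obtain ⟨j, hj, hmax⟩ := WellFounded.has_min (wellFounded_gt (α := Fin n))
          {i | some i ∈ T} (exists_some_mem hnone hT)
        exact ⟨j, hj, fun k hk hkT => hmax k hkT hk⟩
      have hr := (hτ' P l hmove).2
        (fun i hli hi => hlT (hli ▸ (hP.unplayed_iff i).1 hi)) j ((hP.unplayed_iff j).2 hj)
        fun k hk h => hmax k hk ((hP.unplayed_iff k).1 h)
      have hP' := hP.afterRound_ne l (τ P l hmove) (by rw [hr]; exact fun h => hlT (h ▸ hj))
      rw [hr, if_neg hlT, if_pos hj, Finset.erase_eq_of_notMem hlT] at hP'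
      refine ih _ (hm ▸ Finset.card_erase_lt_of_mem hj) hP'
        (fun h => hnone (Finset.mem_of_mem_erase h)) ?_ rfl
      rw [IsHotPosition.sum_afterRound_ne]
      change _ + -1 + c j + _ ≤ v
      by_cases hpartner : ∃ i, M.Adj j i ∧ some i ∈ T
      · obtain ⟨i, hji, hi⟩ := hpartner
        -- As `j` is the greatest unplayed index, it is the upper end of its edge. Losing that edge
        -- costs Right `-(a i + c j)`, at most the `1 - c j` that the round gains him.
        have hlt : i < j := lt_of_le_of_ne (not_lt.1 fun h => hmax i h hi) hji.ne.symm
        have := edgeWeightOn_eq_of_adj hM hlt hji.symm hi hj (Finset.erase_subset (some j) T)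
          (.inr (by simp)) (fun k hk _ h₂ => by simp [hk, h₂])
        have := ha i
        linarith
      · push Not at hpartner
        rw [edgeWeightOn_erase hpartner]
        have := hc j
        linarith

theorem edgeWeightOn_erase_none (M : (auxGraph a c).Subgraph) :
    edgeWeightOn a c M (Finset.univ.erase none) = edgeWeight a c M := by
  unfold edgeWeightOn edgeWeight
  congr 1
  ext p
  simp

/-! ### The common value guaranteed by both players -/

theorem indexOrder_forces {σ : LeftStrategy (Option (Fin n))} {M : (auxGraph a c).Subgraph}
    (ha : ∀ i, 0 ≤ a i) (hσ : IsIndexOrder a c σ) (hM : IsMinWeightMatching a c M) (d : ℤ) :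
    LeftForces IsInteger (fun Q => ∃ k, Q.SumsTo k ∧ d + edgeWeight a c M ≤ k) σ
        (hotSum a c d) ∧
      LeftForces IsOver (fun Q => SignType.sign (d + edgeWeight a c M) ≤ Q.result) σ
        (hotSum a c d) := by
  have hv (N : (auxGraph a c).Subgraph) (hN : N.IsMatching)
      (_ : ∀ i ∈ N.verts, some i ∈ Finset.univ.erase (none : Option (Fin n))) :
      d + edgeWeight a c M ≤
        ∑ i, (Pi.single none d : Option (Fin n) → ℤ) i + edgeWeight a c N := by
    simpa using hM.2 N hN
  refine ⟨leftForces_of_isIndexOrder ha hσ (fun _ _ _ h => h.not_isInteger) ?_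
    (isHotSumPosition_hotSum a c d) (by simp) hv,
    leftForces_of_isIndexOrder ha hσ (fun _ _ _ h => h.not_isOver) ?_
    (isHotSumPosition_hotSum a c d) (by simp) hv⟩
  · exact fun z P hP hz => .reached P hP.isInteger ⟨_, hP.sumsTo, hz⟩
  · exact fun z P hP hz => (hP.leftForces_result σ).mono fun Q hQ => hQ ▸ SignType.sign.monotone hz

theorem exists_matchingStrategy_forces {M : (auxGraph a c).Subgraph}
    (ha : ∀ i, 0 ≤ a i) (hc : ∀ i, c i ≤ 0)
    (hindex : ∀ i j : Fin n, i ≤ j → a j - c j ≤ a i - c i) (hM : M.IsMatching) :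
    ∃ τ : RightStrategy (Option (Fin n)), FollowsMatching a c M τ ∧ ∀ d : ℤ,
      RightForces IsInteger (fun Q => ∃ k, Q.SumsTo k ∧ k ≤ d + edgeWeight a c M) τ
        (hotSum a c d) ∧
      RightForces IsOver (fun Q => Q.result ≤ SignType.sign (d + edgeWeight a c M)) τ
        (hotSum a c d) := by
  obtain ⟨τ, hτ, hτ'⟩ := exists_matchingStrategy M hM
  refine ⟨τ, hτ, fun d => ?_⟩
  have hv : ∑ i, (Pi.single none d : Option (Fin n) → ℤ) i +
      edgeWeightOn a c M (Finset.univ.erase none) ≤ d + edgeWeight a c M := by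
    rw [edgeWeightOn_erase_none]
    simp
  refine ⟨rightForces_of_followsMatching ha hc hindex hM hτ hτ' (fun _ _ _ h => h.not_isInteger) ?_
    (isHotSumPosition_hotSum a c d) (by simp) hv,
    rightForces_of_followsMatching ha hc hindex hM hτ hτ' (fun _ _ _ h => h.not_isOver) ?_
    (isHotSumPosition_hotSum a c d) (by simp) hv⟩
  · exact fun z P hP hz => .reached P hP.isInteger ⟨_, hP.sumsTo, hz⟩
  · exact fun z P hP hz => (hP.rightForces_result τ).mono fun Q hQ => hQ ▸ SignType.sign.monotone hz

/-- Supplies an opponent against which Right's rival strategies are tested. -/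
theorem exists_indexOrder (a c : Fin n → ℤ) :
    ∃ σ : LeftStrategy (Option (Fin n)), IsIndexOrder a c σ := by
  have key (P : SumPosition (Option (Fin n))) (h : Nonempty P.LeftMove) : ∃ l : P.LeftMove,
      ∀ i, Unplayed a c P i → (∀ k < i, ¬ Unplayed a c P k) → l.1 = some i := by
    by_cases hi : ∃ i, Unplayed a c P i ∧ ∀ k < i, ¬ Unplayed a c P k
    · obtain ⟨i, hi, hmin⟩ := hi
      obtain ⟨l⟩ := CRGame.nonempty_left_simpleHot hi
      refine ⟨⟨some i, l⟩, fun j hj hmin' => ?_⟩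
      exact congrArg some
        (le_antisymm (not_lt.1 fun h => hmin j h hj) (not_lt.1 fun h => hmin' i h hi))
    · obtain ⟨l⟩ := h
      exact ⟨l, fun i h h' => absurd ⟨i, h, h'⟩ hi⟩
  choose σ hσ using key
  exact ⟨σ, hσ⟩

end Strategies

/-- Index-order play is optimal for Left, and the matching strategy from any minimum-weight
matching is optimal for Right, in a disjunctive sum of an arbitrary integer and normalized simple
hot games with non-increasing `a_i - c_i`. -/
theorem mainTheorem1 (n : ℕ) (a c : Fin n → ℤ)
    (ha : ∀ i, 0 ≤ a i) (hc : ∀ i, c i ≤ 0)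
    (hindex : ∀ i j : Fin n, i ≤ j → a j - c j ≤ a i - c i) :
    (∀ σ : LeftStrategy (Option (Fin n)), IsIndexOrder a c σ →
      ∀ d : ℤ, LeftIntegerOptimal σ (hotSum a c d) ∧ LeftOutcomeOptimal σ (hotSum a c d)) ∧
    (∀ M : (auxGraph a c).Subgraph, IsMinWeightMatching a c M →
      ∃ τ : RightStrategy (Option (Fin n)), FollowsMatching a c M τ ∧
        ∀ d : ℤ, RightIntegerOptimal τ (hotSum a c d) ∧
          RightOutcomeOptimal τ (hotSum a c d)) := by
  constructor
  · intro σ hσ d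
    obtain ⟨M, hM⟩ := exists_isMinWeightMatching a c
    obtain ⟨τ, -, hτ⟩ := exists_matchingStrategy_forces ha hc hindex hM.1
    have hforce := indexOrder_forces ha hσ hM d
    constructor
    · intro v σ' hσ'
      -- Playing `σ'` against `τ` ends in a position whose sum is at least `v` and at most `d +
      -- edgeWeight a c M`, so index order guarantees `v` too.
      obtain ⟨Q, ⟨k, hk, hvk⟩, k', hk', hle⟩ := hσ'.exists_good (hτ d).1
      obtain rfl := hk.unique hk'
      exact hforce.1.mono fun Q ⟨m, hm, h⟩ => ⟨m, hm, (hvk.trans hle).trans h⟩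
    · intro x σ' hσ'
      obtain ⟨Q, hx, hle⟩ := hσ'.exists_good (hτ d).2
      exact hforce.2.mono fun Q h => (hx.trans hle).trans h
  · intro M hM
    obtain ⟨τ, hτM, hτ⟩ := exists_matchingStrategy_forces ha hc hindex hM.1
    obtain ⟨σ, hσ⟩ := exists_indexOrder a c
    refine ⟨τ, hτM, fun d => ⟨fun v τ' hτ' => ?_, fun x τ' hτ' => ?_⟩⟩
    · obtain ⟨Q, ⟨k, hk, hle⟩, k', hk', hkv⟩ := (indexOrder_forces ha hσ hM d).1.exists_good hτ'
      obtain rfl := hk.unique hk'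
      exact (hτ d).1.mono fun Q ⟨m, hm, h⟩ => ⟨m, hm, h.trans (hle.trans hkv)⟩
    · obtain ⟨Q, hle, hx⟩ := (indexOrder_forces ha hσ hM d).2.exists_good hτ'
      exact (hτ d).2.mono fun Q h => h.trans (hle.trans hx)
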